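/- Let $W=(W_r)_{r\ge 0}$ be a standard $d$-dimensional Brownian motion, let $0\le s\le t$, $h:=t-s$, and let $u:=\tfrac12(s+t)$ be the midpoint of $[s,t]$. For $0\le a\le b$ write $W_{a,b}:=W_b-W_a$ and let $$H_{a,b}:=\frac1{b-a}\int_a^b\Big(W_{a,r}-\frac{r-a}{b-a}W_{a,b}\Big)\,dr$$ be the (rescaled) space-time Lévy area (with $H_{a,a}:=0$). Define the random vectors $$Z_{s,u}:=\tfrac18\,(W_{s,u}-W_{u,t})-\tfrac34\,(H_{s,u}+H_{u,t}),\qquad N_{s,t}:=H_{s,u}-H_{u,t}.$$ Then $W_{s,t},\,H_{s,t},\,Z_{s,u},\,N_{s,t}$ are (jointly) independent, with $$W_{s,t}\sim\mathcal N(0,hI_d),\quad H_{s,t}\sim\mathcal N\big(0,\tfrac{1}{12}hI_d\big),\quad Z_{s,u}\sim\mathcal N\big(0,\tfrac1{16}hI_d\big),\quad N_{s,t}\sim\mathcal N\big(0,\tfrac1{12}hI_d\big).$$ Moreover, almost surely, $$W_{s,u}=\tfrac12W_{s,t}+\tfrac32H_{s,t}+Z_{s,u},\qquad W_{u,t}=\tfrac12W_{s,t}-\tfrac32H_{s,t}-Z_{s,u},$$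 $$H_{s,u}=\tfrac14H_{s,t}-\tfrac12Z_{s,u}+\tfrac12N_{s,t},\qquad H_{u,t}=\tfrac14H_{s,t}-\tfrac12Z_{s,u}-\tfrac12N_{s,t}.$$ -/

import Mathlib

open MeasureTheory ProbabilityTheory
open scoped NNReal

/-- `W` is a standard `d`-dimensional Brownian motion under `P`: its coordinate processes are
independent (as processes) standard one-dimensional Brownian motions (started at `0`, with almost
surely continuous paths). -/
structure IsStandardBrownianMotion {Ω : Type*} [MeasurableSpace Ω] {d : ℕ}
    (W : ℝ≥0 → Ω → EuclideanSpace ℝ (Fin d)) (P : Measure Ω) : Prop where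
  isBrownianReal_coord : ∀ i : Fin d, IsBrownianReal (fun r ω => W r ω i) P
  iIndepFun_coord : iIndepFun (fun (i : Fin d) (ω : Ω) (r : ℝ≥0) => W r ω i) P

/-- The path increment `W_{a,b} = W_b - W_a`. -/
noncomputable def pathIncrement {Ω : Type*} {d : ℕ} (W : ℝ≥0 → Ω → EuclideanSpace ℝ (Fin d))
    (a b : ℝ≥0) (ω : Ω) : EuclideanSpace ℝ (Fin d) :=
  W b ω - W a ω

/-- The rescaled space-time Lévy area
`H_{a,b} = (b - a)⁻¹ ∫_a^b (W_{a,r} - (r - a) / (b - a) * W_{a,b}) dr`, pathwise.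
The integration variable is real and lies in `[a, b]`, where `r.toNNReal` is `r`.
For `a = b` the value is `0`. -/
noncomputable def spaceTimeLevyArea {Ω : Type*} {d : ℕ} (W : ℝ≥0 → Ω → EuclideanSpace ℝ (Fin d))
    (a b : ℝ≥0) (ω : Ω) : EuclideanSpace ℝ (Fin d) :=
  (1 / ((b : ℝ) - a)) •
    ∫ r in (a : ℝ)..b,
      (pathIncrement W a r.toNNReal ω - ((r - a) / ((b : ℝ) - a)) • pathIncrement W a b ω)

/-- `Z_{s,u} = (W_{s,u} - W_{u,t}) / 8 - (3 / 4) (H_{s,u} + H_{u,t})`. -/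
noncomputable def midpointArch {Ω : Type*} {d : ℕ} (W : ℝ≥0 → Ω → EuclideanSpace ℝ (Fin d))
    (s u t : ℝ≥0) (ω : Ω) : EuclideanSpace ℝ (Fin d) :=
  (1 / 8 : ℝ) • (pathIncrement W s u ω - pathIncrement W u t ω)
    - (3 / 4 : ℝ) • (spaceTimeLevyArea W s u ω + spaceTimeLevyArea W u t ω)

/-- `N_{s,t} = H_{s,u} - H_{u,t}`. -/
noncomputable def levyAreaDifference {Ω : Type*} {d : ℕ}
    (W : ℝ≥0 → Ω → EuclideanSpace ℝ (Fin d)) (s u t : ℝ≥0) (ω : Ω) :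
    EuclideanSpace ℝ (Fin d) :=
  spaceTimeLevyArea W s u ω - spaceTimeLevyArea W u t ω

/-!
For a continuous path, rescaling to the unit interval shows that the space-time Lévy area over
`[a, b]` is the mean of the path over `[a, b]` minus the mean of its endpoint values
(`spaceTimeLevyArea_apply`). Summation by parts in a Riemann sum for this mean exhibits
`p W_{a,b} + q H_{a,b}` as the limit of sums of Brownian increments with weights
`p + q (1/2 - x)`, that is, as the Wiener integral of this function of the rescaled time `x`
(`tendsto_wienerSum`). The approximating sums are centred Gaussian, since increments over disjoint
intervals and the coordinate processes are independent, and their variances converge to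
`(b - a) (p ^ 2 + q ^ 2 / 12)` per coordinate. By dominated convergence this yields the joint
characteristic function of the increments and Lévy areas over the two half-intervals
(`IsStandardBrownianMotion.integral_cexp_halves`): they are independent Gaussian vectors.

The vectors `W_{s,t}`, `H_{s,t}`, `Z_{s,u}`, `N_{s,t}` are linear combinations of those four, by
`spaceTimeLevyArea_eq_of_midpoint` for `H_{s,t}`, and the resulting quadratic form in the
characteristic function is diagonal. A joint characteristic function of this shape means independence
with the asserted laws (`iIndepFun_and_hasLaw_multivariateGaussian`), and the almost sure identities
come from inverting the linear relations.
-/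

/-! ### Riemann sums and summation by parts -/

open Filter Topology in
lemma tendsto_riemannSum_unitInterval {g : ℝ → ℝ} (hg : Continuous g) :
    Tendsto (fun n : ℕ => (∑ k ∈ Finset.range n, g (k / n)) / (n : ℝ)) atTop
      (𝓝 (∫ x in (0 : ℝ)..1, g x)) := by
  rw [Metric.tendsto_atTop]
  intro ε hε
  have huc : UniformContinuousOn g (Set.Icc 0 1) :=
    isCompact_Icc.uniformContinuousOn_of_continuous hg.continuousOn
  obtain ⟨δ, hδ, hgδ⟩ := Metric.uniformContinuousOn_iff.1 huc (ε / 2) (half_pos hε)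
  obtain ⟨m, hm⟩ := exists_nat_gt (1 / δ)
  refine ⟨max m 1, fun n hn => ?_⟩
  have hn0 : (0 : ℝ) < n := by
    have : 1 ≤ n := le_trans (le_max_right _ _) hn
    exact_mod_cast this
  have hnδ : 1 / (n : ℝ) < δ := by
    have : (m : ℝ) ≤ n := by exact_mod_cast le_trans (le_max_left _ _) hn
    rw [div_lt_comm₀ hn0 hδ]
    linarith
  have hsplit : ∑ k ∈ Finset.range n, ∫ x in ((k : ℕ) / n : ℝ)..((k + 1 : ℕ) / n : ℝ), g x
      = ∫ x in (0 : ℝ)..1, g x := by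
    rw [intervalIntegral.sum_integral_adjacent_intervals (a := fun k : ℕ => (k / n : ℝ))
      (fun k _ => hg.intervalIntegrable _ _)]
    simp [hn0.ne']
  have hterm : ∀ k ∈ Finset.range n,
      |g (k / n) / n - ∫ x in ((k : ℕ) / n : ℝ)..((k + 1 : ℕ) / n : ℝ), g x| ≤ ε / 2 / n := by
    intro k hk
    have hk' : (k : ℝ) + 1 ≤ n := by exact_mod_cast Finset.mem_range.1 hk
    have hlen : ((k + 1 : ℕ) / n : ℝ) - k / n = 1 / n := by push_cast; ring
    have hconst : g (k / n) / n = ∫ _x in ((k : ℕ) / n : ℝ)..((k + 1 : ℕ) / n : ℝ), g (k / n) := by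
      rw [intervalIntegral.integral_const, hlen, smul_eq_mul]; ring
    rw [hconst, ← intervalIntegral.integral_sub intervalIntegrable_const
      (hg.intervalIntegrable _ _)]
    have hle : (k / n : ℝ) ≤ (k + 1 : ℕ) / n := by push_cast; gcongr; linarith
    have := intervalIntegral.norm_integral_le_of_norm_le_const (a := (k / n : ℝ))
      (b := (k + 1 : ℕ) / n) (f := fun x => g (k / n) - g x) (C := ε / 2) (fun x hx => by
        rw [Set.uIoc_of_le hle] at hx
        have h0 : (0 : ℝ) ≤ k / n := by positivity
        have h1 : ((k + 1 : ℕ) / n : ℝ) ≤ 1 := by rw [div_le_one hn0]; push_cast; exact hk'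
        rw [← dist_eq_norm]
        refine (hgδ _ ⟨h0, hle.trans h1⟩ _ ⟨h0.trans hx.1.le, hx.2.trans h1⟩ ?_).le
        rw [dist_comm, Real.dist_eq, abs_of_pos (sub_pos.2 hx.1)]
        linarith [hx.2])
    rw [hlen, abs_of_pos (by positivity : (0 : ℝ) < 1 / n)] at this
    rw [← Real.norm_eq_abs]
    refine this.trans (le_of_eq ?_)
    ring
  rw [Real.dist_eq, Finset.sum_div, ← hsplit, ← Finset.sum_sub_distrib]
  calc _ ≤ ∑ k ∈ Finset.range n, ε / 2 / n :=
        (Finset.abs_sum_le_sum_abs _ _).trans (Finset.sum_le_sum hterm)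
    _ = ε / 2 := by simp; field_simp
    _ < ε := half_lt_self hε

/-- Summation by parts against a weight that is affine in the index. -/
lemma sum_affine_mul_increment (f : ℕ → ℝ) (A : ℝ) (m : ℕ) :
    ∑ j ∈ Finset.range m, (A - j) * (f (j + 1) - f j)
      = (A - m + 1) * f m - (A + 1) * f 0 + ∑ j ∈ Finset.range m, f j := by
  induction m with
  | zero => simp
  | succ m ih => rw [Finset.sum_range_succ, Finset.sum_range_succ, ih]; push_cast; ring

open Filter Topology in
/-- The weights `p + q (1/2 - (j + 1) / n)` are those of the increments in the discretisation
`tendsto_wienerSum`; their mean square tends to `∫ x in 0..1, (p + q (1/2 - x)) ^ 2`. -/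
lemma tendsto_sum_sq_wienerWeight (p q : ℝ) :
    Tendsto (fun n : ℕ => (∑ j ∈ Finset.range n,
      (p + q * (1 / 2 - 1 / (n : ℝ) - j / n)) ^ 2) / (n : ℝ)) atTop (𝓝 (p ^ 2 + q ^ 2 / 12)) := by
  have key := tendsto_riemannSum_unitInterval (g := fun x => (p + q * (x - 1 / 2)) ^ 2)
    (by fun_prop)
  have hint : ∫ x in (0 : ℝ)..1, (p + q * (x - 1 / 2)) ^ 2 = p ^ 2 + q ^ 2 / 12 := by
    have hderiv : ∀ x ∈ Set.uIcc (0 : ℝ) 1, HasDerivAt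
        (fun x : ℝ => p ^ 2 * x + p * q * (x - 1 / 2) ^ 2 + q ^ 2 / 3 * (x - 1 / 2) ^ 3)
        ((p + q * (x - 1 / 2)) ^ 2) x := fun x _ => by
      have hx : HasDerivAt (fun x : ℝ => x - 1 / 2) 1 x := (hasDerivAt_id x).sub_const _
      refine ((((hasDerivAt_id x).const_mul (p ^ 2)).add ((hx.pow 2).const_mul (p * q))).add
        ((hx.pow 3).const_mul (q ^ 2 / 3))).congr_deriv ?_
      simp
      ring
    rw [intervalIntegral.integral_eq_sub_of_hasDerivAt hderiv
      (Continuous.intervalIntegrable (by fun_prop) _ _)]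
    ring
  rw [hint] at key
  refine key.congr fun n => ?_
  congr 1
  -- The values of the integrand at left endpoints, in reversed order, are the weights.
  rw [← Finset.sum_range_reflect]
  refine Finset.sum_congr rfl fun j hj => ?_
  have hj' : j + 1 ≤ n := Finset.mem_range.1 hj
  have hn : (n : ℝ) ≠ 0 := by
    have : n ≠ 0 := by omega
    exact_mod_cast this
  rw [show n - 1 - j = n - (j + 1) by omega, Nat.cast_sub hj']
  push_cast
  congr 2
  field_simp
  ring

/-- The mean of `f` over `[a, b]` minus the mean of its two endpoint values. The mean is written as
an integral over the unit interval, so that no division by `b - a` occurs and the value at `a = b`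
is `0`. -/
noncomputable def meanGap (f : ℝ → ℝ) (a b : ℝ) : ℝ :=
  (∫ x in (0 : ℝ)..1, f (a + (b - a) * x)) - (f a + f b) / 2

/-- Splitting at the midpoint: the mean over `[a, b]` is the average of the means over the two
halves, and the means of endpoint values differ by a second difference of `f` over the halves. -/
lemma meanGap_eq_of_midpoint {f : ℝ → ℝ} (hf : Continuous f) {a b m : ℝ} (hm : m = (a + b) / 2) :
    meanGap f a b = (1 / 4) * ((f m - f a) - (f b - f m))
      + (1 / 2) * (meanGap f a m + meanGap f m b) := by
  have hg : Continuous fun x => f (a + (b - a) * x) := by fun_prop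
  have h1 : ∫ x in (0 : ℝ)..1, f (a + (m - a) * x)
      = 2 * ∫ x in (0 : ℝ)..(1 / 2), f (a + (b - a) * x) := by
    have := intervalIntegral.integral_comp_div (a := 0) (b := 1)
      (fun x => f (a + (b - a) * x)) (two_ne_zero (α := ℝ))
    rw [zero_div, smul_eq_mul] at this
    rw [← this]
    congr with x
    rw [hm]; ring_nf
  have h2 : ∫ x in (0 : ℝ)..1, f (m + (b - m) * x)
      = 2 * ∫ x in (1 / 2 : ℝ)..1, f (a + (b - a) * x) := by
    have := intervalIntegral.integral_comp_div_add (a := 0) (b := 1)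
      (fun x => f (a + (b - a) * x)) (two_ne_zero (α := ℝ)) (1 / 2)
    rw [zero_div, zero_add, add_halves, smul_eq_mul] at this
    rw [← this]
    congr with x
    rw [hm]; ring_nf
  have h3 := intervalIntegral.integral_add_adjacent_intervals
    (hg.intervalIntegrable (μ := volume) 0 (1 / 2)) (hg.intervalIntegrable (1 / 2) 1)
  simp only [meanGap, h1, h2, ← h3]
  ring

open Filter Topology in
/-- Summation by parts turns the weighted sum of increments into `p` times the total increment plus
`q` times a Riemann-sum version of `meanGap`. -/
lemma tendsto_wienerSum {f : ℝ → ℝ} (hf : Continuous f) (a b p q : ℝ) :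
    Tendsto (fun n : ℕ => ∑ j ∈ Finset.range n, (p + q * (1 / 2 - 1 / (n : ℝ) - j / n))
        * (f (a + (b - a) * ((j + 1 : ℕ) / n)) - f (a + (b - a) * (j / n)))) atTop
      (𝓝 (p * (f b - f a) + q * meanGap f a b)) := by
  have hlim := ((tendsto_riemannSum_unitInterval (g := fun x => f (a + (b - a) * x))
    (by fun_prop)).sub_const ((f a + f b) / 2)).const_mul q |>.const_add (p * (f b - f a))
  refine hlim.congr' ?_
  filter_upwards [eventually_ge_atTop 1] with n hn
  have hn0 : (n : ℝ) ≠ 0 := by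
    have : n ≠ 0 := by omega
    exact_mod_cast this
  have hA := sum_affine_mul_increment (fun j => f (a + (b - a) * (j / n))) (n / 2 - 1) n
  have hF := Finset.sum_range_sub (fun j : ℕ => f (a + (b - a) * (j / n))) n
  have hb : f (a + (b - a) * ((n : ℝ) / n)) = f b := by rw [div_self hn0]; ring_nf
  have ha : f (a + (b - a) * (((0 : ℕ) : ℝ) / n)) = f a := by simp
  simp only [hb, ha] at hA hF
  have hsplit : ∀ j : ℕ, (p + q * (1 / 2 - 1 / (n : ℝ) - j / n))
        * (f (a + (b - a) * ((j + 1 : ℕ) / n)) - f (a + (b - a) * (j / n)))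
      = p * (f (a + (b - a) * ((j + 1 : ℕ) / n)) - f (a + (b - a) * (j / n)))
        + q / n * ((n / 2 - 1 - j) *
          (f (a + (b - a) * ((j + 1 : ℕ) / n)) - f (a + (b - a) * (j / n)))) := fun j => by
    field_simp
  simp_rw [hsplit]
  rw [Finset.sum_add_distrib, ← Finset.mul_sum, ← Finset.mul_sum, hA, hF]
  field_simp
  ring

/-! ### Space-time Lévy area of a continuous path -/

/-- Rescaling `[a, b]` to the unit interval, the linear interpolation subtracted in the Lévy area
contributes the mean of the endpoint values. The identity also holds for `a = b`, where both sides
vanish. -/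
lemma spaceTimeLevyArea_apply {Ω : Type*} {d : ℕ} {W : ℝ≥0 → Ω → EuclideanSpace ℝ (Fin d)}
    {ω : Ω} (hω : Continuous fun r => W r ω) (a b : ℝ≥0) (i : Fin d) :
    spaceTimeLevyArea W a b ω i = meanGap (fun r => W r.toNNReal ω i) a b := by
  rcases eq_or_ne a b with rfl | hab
  · simp [spaceTimeLevyArea, meanGap]
  have hc : ((b : ℝ) - a) ≠ 0 := sub_ne_zero.2 (by exact_mod_cast hab.symm)
  have hf : Continuous fun r : ℝ => W r.toNNReal ω := hω.comp continuous_real_toNNReal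
  have hfi : Continuous fun r : ℝ => W r.toNNReal ω i := by fun_prop
  have hsubst := intervalIntegral.integral_comp_add_mul (a := 0) (b := 1)
    (fun r : ℝ => (W r.toNNReal ω i - W a ω i)
      - ((r - a) / ((b : ℝ) - a)) * (W b ω i - W a ω i)) hc (a : ℝ)
  rw [mul_zero, add_zero, mul_one, add_sub_cancel, smul_eq_mul] at hsubst
  have hcoord : (∫ r in (a : ℝ)..b, (pathIncrement W a r.toNNReal ω
        - ((r - a) / ((b : ℝ) - a)) • pathIncrement W a b ω)) i
      = ∫ r in (a : ℝ)..b, ((W r.toNNReal ω i - W a ω i)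
        - ((r - a) / ((b : ℝ) - a)) * (W b ω i - W a ω i)) := by
    have hint : IntervalIntegrable (fun r : ℝ => pathIncrement W a r.toNNReal ω
        - ((r - a) / ((b : ℝ) - a)) • pathIncrement W a b ω) volume a b := by
      unfold pathIncrement
      exact Continuous.intervalIntegrable (by fun_prop) _ _
    have := (EuclideanSpace.proj (𝕜 := ℝ) i).intervalIntegral_comp_comm hint
    simpa [pathIncrement] using this.symm
  rw [spaceTimeLevyArea, PiLp.smul_apply, hcoord, smul_eq_mul, one_div, ← hsubst]
  have hx : ∀ x : ℝ, (a + ((b : ℝ) - a) * x - a) / ((b : ℝ) - a) = x := fun x => by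
    field_simp; ring
  simp_rw [hx]
  rw [intervalIntegral.integral_sub (Continuous.intervalIntegrable (by fun_prop) _ _)
      (Continuous.intervalIntegrable (by fun_prop) _ _),
    intervalIntegral.integral_sub (Continuous.intervalIntegrable (by fun_prop) _ _)
      intervalIntegrable_const, intervalIntegral.integral_mul_const]
  simp [meanGap]
  ring

/-- Chen-type relation expressing `H_{s,t}` through the increments and Lévy areas of the halves;
all the almost sure identities follow from it by linear algebra. -/
lemma spaceTimeLevyArea_eq_of_midpoint {Ω : Type*} {d : ℕ}
    {W : ℝ≥0 → Ω → EuclideanSpace ℝ (Fin d)} {ω : Ω} (hω : Continuous fun r => W r ω)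
    {s t u : ℝ≥0} (hu : u = (s + t) / 2) :
    spaceTimeLevyArea W s t ω
      = (1 / 4 : ℝ) • (pathIncrement W s u ω - pathIncrement W u t ω)
        + (1 / 2 : ℝ) • (spaceTimeLevyArea W s u ω + spaceTimeLevyArea W u t ω) := by
  ext i
  have hf : Continuous fun r : ℝ => W r.toNNReal ω := hω.comp continuous_real_toNNReal
  have hu' : (u : ℝ) = (s + t) / 2 := by rw [hu]; push_cast; rfl
  have := meanGap_eq_of_midpoint (f := fun r : ℝ => W r.toNNReal ω i) (by fun_prop) hu'
  simp only [PiLp.add_apply, PiLp.sub_apply, PiLp.smul_apply, smul_eq_mul,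
    spaceTimeLevyArea_apply hω, this, pathIncrement, Real.toNNReal_coe]

/-! ### Gaussian characteristic functions -/

open Filter Topology in
/-- An almost sure limit of centred Gaussian variables with convergent variances has the Gaussian
characteristic function, evaluated at `1`, of the limiting variance. -/
lemma integral_cexp_of_tendsto_ae {Ω : Type*} [MeasurableSpace Ω] {P : Measure Ω}
    [IsProbabilityMeasure P] {X : ℕ → Ω → ℝ} {Y : Ω → ℝ} {v : ℕ → ℝ} {v₀ : ℝ}
    (hX : ∀ n, AEMeasurable (X n) P) (hY : ∀ᵐ ω ∂P, Tendsto (fun n => X n ω) atTop (𝓝 (Y ω)))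
    (hv : Tendsto v atTop (𝓝 v₀))
    (hchar : ∀ n, charFun (P.map (X n)) 1 = Complex.exp (-(v n : ℝ) / 2)) :
    ∫ ω, Complex.exp ((Y ω : ℝ) * Complex.I) ∂P = Complex.exp (-(v₀ : ℝ) / 2) := by
  have hint : ∀ n, ∫ ω, Complex.exp ((X n ω : ℝ) * Complex.I) ∂P
      = Complex.exp (-(v n : ℝ) / 2) := fun n => by
    rw [← hchar n, charFun_apply_real, integral_map (hX n) (by fun_prop)]
    simp
  have h1 : Tendsto (fun n => ∫ ω, Complex.exp ((X n ω : ℝ) * Complex.I) ∂P) atTop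
      (𝓝 (∫ ω, Complex.exp ((Y ω : ℝ) * Complex.I) ∂P)) := by
    refine tendsto_integral_of_dominated_convergence (fun _ => 1) (fun n => ?_)
      (integrable_const _) (fun n => ?_) ?_
    · exact ((by fun_prop : Measurable fun x : ℝ =>
        Complex.exp ((x : ℝ) * Complex.I)).comp_aemeasurable (hX n)).aestronglyMeasurable
    · simp [Complex.norm_exp_ofReal_mul_I]
    · filter_upwards [hY] with ω hω
      exact ((by fun_prop : Continuous fun x : ℝ =>
        Complex.exp ((x : ℝ) * Complex.I)).tendsto (Y ω)).comp hω
  simp_rw [hint] at h1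
  refine tendsto_nhds_unique h1 ?_
  exact ((by fun_prop : Continuous fun x : ℝ =>
    Complex.exp (-(x : ℝ) / 2)).tendsto v₀).comp hv

/-- Random vectors whose joint characteristic function is that of independent isotropic centred
Gaussian vectors are independent with these laws. -/
lemma iIndepFun_and_hasLaw_multivariateGaussian {Ω ι κ : Type*} [MeasurableSpace Ω]
    [Fintype ι] [DecidableEq ι] [Fintype κ] {P : Measure Ω}
    [IsProbabilityMeasure P] {X : κ → Ω → EuclideanSpace ℝ ι} {v : κ → ℝ}
    (hX : ∀ k, AEMeasurable (X k) P) (hv : ∀ k, 0 ≤ v k)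
    (hchar : ∀ t : κ → EuclideanSpace ℝ ι,
      ∫ ω, Complex.exp ((∑ k, inner ℝ (X k ω) (t k) : ℝ) * Complex.I) ∂P
        = Complex.exp (-(∑ k, v k * ‖t k‖ ^ 2 : ℝ) / 2)) :
    iIndepFun X P ∧
      ∀ k, HasLaw (X k) (multivariateGaussian 0 (v k • (1 : Matrix ι ι ℝ))) P := by
  classical
  -- The marginal characteristic functions are the joint one at vectors supported on a single index.
  have hmarg : ∀ k t, charFun (P.map (X k)) t = Complex.exp (-(v k * ‖t‖ ^ 2 : ℝ) / 2) := by
    intro k t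
    have h := hchar (Pi.single k t)
    have h1 : ∀ ω, ∑ l, inner ℝ (X l ω) ((Pi.single k t : κ → EuclideanSpace ℝ ι) l)
        = inner ℝ (X k ω) t := fun ω => by
      rw [Finset.sum_eq_single k (fun l _ hl => by simp [Pi.single_eq_of_ne hl]) (by simp)]
      simp
    have h2 : ∑ l, v l * ‖(Pi.single k t : κ → EuclideanSpace ℝ ι) l‖ ^ 2 = v k * ‖t‖ ^ 2 := by
      rw [Finset.sum_eq_single k (fun l _ hl => by simp [Pi.single_eq_of_ne hl]) (by simp)]
      simp
    simp_rw [h1, h2] at h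
    rw [charFun_apply, integral_map (hX k) (by fun_prop), h]
  refine ⟨?_, fun k => ⟨hX k, ?_⟩⟩
  · rw [iIndepFun_iff_charFun_pi hX]
    intro t
    have hjoint : AEMeasurable (fun ω => WithLp.toLp 2 (fun k => X k ω)) P :=
      (WithLp.measurable_toLp 2 _).comp_aemeasurable (aemeasurable_pi_lambda _ hX)
    rw [charFun_apply, integral_map hjoint (by fun_prop)]
    simp only [PiLp.inner_apply (𝕜 := ℝ) (ι := κ)]
    rw [hchar (fun k => t k)]
    simp_rw [hmarg]
    rw [← Complex.exp_sum, ← Finset.sum_div, Finset.sum_neg_distrib, ← Complex.ofReal_sum]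
  · have hpos : (v k • (1 : Matrix ι ι ℝ)).PosSemidef := Matrix.PosSemidef.one.smul (hv k)
    have : IsProbabilityMeasure (P.map (X k)) := Measure.isProbabilityMeasure_map (hX k)
    refine Measure.ext_of_charFun ?_
    ext t
    rw [hmarg, charFun_multivariateGaussian hpos, EuclideanSpace.real_norm_sq_eq]
    congr 1
    simp only [inner_zero_right, Complex.ofReal_zero, zero_mul, zero_sub, neg_div,
      Matrix.smul_mulVec, Matrix.one_mulVec, dotProduct, Pi.smul_apply, smul_eq_mul,
      Finset.mul_sum]
    congr 3
    refine Finset.sum_congr rfl fun i _ => ?_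
    ring

/-! ### Brownian increments and Lévy areas over the two half-intervals -/

lemma aemeasurable_euclideanSpace {Ω : Type*} [MeasurableSpace Ω] {P : Measure Ω}
    {ι : Type*} [Fintype ι] {X : Ω → EuclideanSpace ℝ ι}
    (hX : ∀ i, AEMeasurable (fun ω => X ω i) P) : AEMeasurable X P :=
  (WithLp.measurable_toLp 2 _).comp_aemeasurable (aemeasurable_pi_lambda _ hX)

lemma ProbabilityTheory.IsPreBrownianReal.charFun_sum_mul_increment {Ω : Type*}
    [MeasurableSpace Ω] {P : Measure Ω} {B : ℝ≥0 → Ω → ℝ} (hB : IsPreBrownianReal B P)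
    {τ : ℕ → ℝ≥0} (hτ : Monotone τ) (c : ℕ → ℝ) (n : ℕ) :
    charFun (P.map (fun ω => ∑ j ∈ Finset.range n, c j * (B (τ (j + 1)) ω - B (τ j) ω))) 1
      = Complex.exp (-(∑ j ∈ Finset.range n, c j ^ 2 * ((τ (j + 1) : ℝ) - τ j) : ℝ) / 2) := by
  have hind : iIndepFun (fun (j : ℕ) ω => c j * (B (τ (j + 1)) ω - B (τ j) ω)) P :=
    (hB.hasIndepIncrements.nat hτ).comp (fun j x => c j * x) (fun j => by fun_prop)
  have hm : ∀ j, AEMeasurable (fun ω => c j * (B (τ (j + 1)) ω - B (τ j) ω)) P := fun j =>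
    ((hB.aemeasurable _).sub (hB.aemeasurable _)).const_mul _
  rw [iIndepFun.charFun_map_fun_finsetSum_eq_prod (fun j _ => hm j) (hind.restrict _),
    Finset.prod_apply]
  have hlaw : ∀ j, charFun (P.map (fun ω => c j * (B (τ (j + 1)) ω - B (τ j) ω))) 1
      = Complex.exp (-(c j ^ 2 * ((τ (j + 1) : ℝ) - τ j) : ℝ) / 2) := fun j => by
    have h := gaussianReal_const_mul (hB.hasLaw_sub (τ (j + 1)) (τ j)) (c j)
    have h' := h.map_eq
    simp only [Pi.sub_apply] at h'
    rw [h', charFun_gaussianReal]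
    have hle : (τ j : ℝ) ≤ τ (j + 1) := hτ (Nat.le_succ j)
    congr 1
    simp [NNReal.coe_mk, Real.dist_eq, abs_of_nonneg (sub_nonneg.2 hle)]
    ring
  simp_rw [hlaw]
  rw [← Complex.exp_sum, ← Finset.sum_div, Finset.sum_neg_distrib, ← Complex.ofReal_sum]

section

variable {Ω : Type*} [MeasurableSpace Ω] {P : Measure Ω}
  {d : ℕ} {W : ℝ≥0 → Ω → EuclideanSpace ℝ (Fin d)}

lemma IsStandardBrownianMotion.ae_continuous (hW : IsStandardBrownianMotion W P) :
    ∀ᵐ ω ∂P, Continuous fun r => W r ω := by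
  filter_upwards [ae_all_iff.2 fun i => (hW.isBrownianReal_coord i).cont] with ω hω
  exact (PiLp.continuous_toLp 2 _).comp (continuous_pi hω)

lemma IsStandardBrownianMotion.charFun_sum_mul_increment (hW : IsStandardBrownianMotion W P)
    {τ : ℕ → ℝ≥0} (hτ : Monotone τ) (c : Fin d → ℕ → ℝ) (n : ℕ) :
    charFun (P.map (fun ω => ∑ i, ∑ j ∈ Finset.range n,
        c i j * (W (τ (j + 1)) ω i - W (τ j) ω i))) 1
      = Complex.exp
        (-(∑ i, ∑ j ∈ Finset.range n, c i j ^ 2 * ((τ (j + 1) : ℝ) - τ j) : ℝ) / 2) := by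
  have hind : iIndepFun (fun (i : Fin d) ω => ∑ j ∈ Finset.range n,
      c i j * (W (τ (j + 1)) ω i - W (τ j) ω i)) P :=
    hW.iIndepFun_coord.comp
      (fun i w => ∑ j ∈ Finset.range n, c i j * (w (τ (j + 1)) - w (τ j))) (fun i => by fun_prop)
  have hm : ∀ i, AEMeasurable (fun ω => ∑ j ∈ Finset.range n,
      c i j * (W (τ (j + 1)) ω i - W (τ j) ω i)) P := fun i =>
    Finset.aemeasurable_fun_sum _ fun j _ =>
      (((hW.isBrownianReal_coord i).aemeasurable _).sub
        ((hW.isBrownianReal_coord i).aemeasurable _)).const_mul _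
  rw [hind.charFun_map_fun_sum_eq_prod hm, Finset.prod_apply]
  simp_rw [fun i => (hW.isBrownianReal_coord i).charFun_sum_mul_increment hτ (c i) n]
  rw [← Complex.exp_sum, ← Finset.sum_div, Finset.sum_neg_distrib, ← Complex.ofReal_sum]

lemma IsStandardBrownianMotion.aemeasurable_pathIncrement (hW : IsStandardBrownianMotion W P)
    (a b : ℝ≥0) : AEMeasurable (pathIncrement W a b) P :=
  aemeasurable_euclideanSpace fun i => ((hW.isBrownianReal_coord i).aemeasurable b).sub
    ((hW.isBrownianReal_coord i).aemeasurable a)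

lemma IsStandardBrownianMotion.aemeasurable_spaceTimeLevyArea
    (hW : IsStandardBrownianMotion W P) (a b : ℝ≥0) :
    AEMeasurable (spaceTimeLevyArea W a b) P := by
  refine aemeasurable_euclideanSpace fun i => ?_
  have hm : ∀ r : ℝ, AEMeasurable (fun ω => W r.toNNReal ω i) P := fun r =>
    (hW.isBrownianReal_coord i).aemeasurable _
  -- With weights `p = 0`, `q = 1` the discretisation converges to the Lévy area itself.
  refine aemeasurable_of_tendsto_metrizable_ae Filter.atTop
    (f := fun (n : ℕ) ω => ∑ j ∈ Finset.range n, (0 + 1 * (1 / 2 - 1 / (n : ℝ) - j / n))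
        * (W ((a : ℝ) + ((b : ℝ) - a) * ((j + 1 : ℕ) / n)).toNNReal ω i
          - W ((a : ℝ) + ((b : ℝ) - a) * (j / n)).toNNReal ω i)) (fun n => ?_) ?_
  · exact Finset.aemeasurable_fun_sum _ fun j _ => ((hm _).sub (hm _)).const_mul _
  · filter_upwards [hW.ae_continuous] with ω hω
    rw [spaceTimeLevyArea_apply hω]
    have hf : Continuous fun r : ℝ => W r.toNNReal ω := hω.comp continuous_real_toNNReal
    simpa using tendsto_wienerSum (f := fun r : ℝ => W r.toNNReal ω i) (by fun_prop) a b 0 1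

open Filter Topology in
/-- Joint characteristic function of the increments and Lévy areas over the two halves of `[s, t]`:
they are independent, with variances `h / 2` and `h / 24` per coordinate for `h = t - s`. The linear
combination is the almost sure limit of weighted sums of independent increments over a uniform grid
with `2 n` steps. -/
lemma IsStandardBrownianMotion.integral_cexp_halves [IsProbabilityMeasure P]
    (hW : IsStandardBrownianMotion W P) {s t u : ℝ≥0} (hst : s ≤ t) (hu : u = (s + t) / 2)
    (p p' q q' : Fin d → ℝ) :
    ∫ ω, Complex.exp ((∑ i, ((p i * pathIncrement W s u ω i + q i * spaceTimeLevyArea W s u ω i)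
        + (p' i * pathIncrement W u t ω i + q' i * spaceTimeLevyArea W u t ω i)) : ℝ)
          * Complex.I) ∂P
      = Complex.exp (-(∑ i, ((t : ℝ) - s) / 2
        * ((p i ^ 2 + q i ^ 2 / 12) + (p' i ^ 2 + q' i ^ 2 / 12)) : ℝ) / 2) := by
  have hu' : (u : ℝ) = (s + t) / 2 := by rw [hu]; push_cast; rfl
  set τ : ℕ → ℕ → ℝ≥0 := fun n j => s + (t - s) / 2 * (j / n) with hτdef
  have hτcoe : ∀ n j, (τ n j : ℝ) = s + ((u : ℝ) - s) * (j / n) := fun n j => by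
    simp only [hτdef, NNReal.coe_add, NNReal.coe_mul, NNReal.coe_div, NNReal.coe_sub hst, hu',
      NNReal.coe_ofNat, NNReal.coe_natCast]
    ring
  have hτ : ∀ n, Monotone (τ n) := fun n j k hjk => by
    simp only [hτdef]
    gcongr
  have hτadd : ∀ n j, n ≠ 0 → (τ n (n + j) : ℝ) = u + ((t : ℝ) - u) * (j / n) := fun n j hn => by
    have : (n : ℝ) ≠ 0 := by exact_mod_cast hn
    rw [hτcoe, hu']
    push_cast
    field_simp
    ring
  -- The first `n` steps of the grid cover `[s, u]` and the last `n` cover `[u, t]`.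
  set c : ℕ → Fin d → ℕ → ℝ := fun n i j =>
    if j < n then p i + q i * (1 / 2 - 1 / (n : ℝ) - j / n)
    else p' i + q' i * (1 / 2 - 1 / (n : ℝ) - (j - n : ℕ) / n) with hcdef
  have hc₁ : ∀ n i j, j ∈ Finset.range n →
      c n i j = p i + q i * (1 / 2 - 1 / (n : ℝ) - j / n) := fun n i j hj => by
    simp only [hcdef, if_pos (Finset.mem_range.1 hj)]
  have hc₂ : ∀ n i j, c n i (n + j) = p' i + q' i * (1 / 2 - 1 / (n : ℝ) - j / n) :=
    fun n i j => by simp [hcdef]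
  refine integral_cexp_of_tendsto_ae
    (X := fun n ω => ∑ i, ∑ j ∈ Finset.range (n + n),
      c n i j * (W (τ n (j + 1)) ω i - W (τ n j) ω i))
    (v := fun n => ∑ i, ∑ j ∈ Finset.range (n + n),
      c n i j ^ 2 * ((τ n (j + 1) : ℝ) - τ n j)) (fun n => ?_) ?_ ?_
    (fun n => hW.charFun_sum_mul_increment (hτ n) (c n) (n + n))
  · exact Finset.aemeasurable_fun_sum _ fun i _ => Finset.aemeasurable_fun_sum _ fun j _ =>
      (((hW.isBrownianReal_coord i).aemeasurable _).sub
        ((hW.isBrownianReal_coord i).aemeasurable _)).const_mul _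
  · filter_upwards [hW.ae_continuous] with ω hω
    refine tendsto_finsetSum _ fun i _ => ?_
    have hf : Continuous fun r : ℝ => W r.toNNReal ω := hω.comp continuous_real_toNNReal
    have hfi : Continuous fun r : ℝ => W r.toNNReal ω i := by fun_prop
    have h₁ := tendsto_wienerSum hfi s u (p i) (q i)
    have h₂ := tendsto_wienerSum hfi u t (p' i) (q' i)
    have h := h₁.add h₂
    simp only [Real.toNNReal_coe] at h
    simp only [spaceTimeLevyArea_apply hω, pathIncrement, PiLp.sub_apply]
    refine h.congr' ?_
    filter_upwards [eventually_ge_atTop 1] with n hn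
    rw [Finset.sum_range_add]
    congr 1
    · refine Finset.sum_congr rfl fun j hj => ?_
      rw [hc₁ n i j hj, ← hτcoe, ← hτcoe, Real.toNNReal_coe, Real.toNNReal_coe]
    · refine Finset.sum_congr rfl fun j hj => ?_
      rw [hc₂, ← hτadd n _ (by omega), ← hτadd n _ (by omega), Real.toNNReal_coe,
        Real.toNNReal_coe, add_assoc]
  · refine tendsto_finsetSum _ fun i _ => ?_
    have h := ((tendsto_sum_sq_wienerWeight (p i) (q i)).add
      (tendsto_sum_sq_wienerWeight (p' i) (q' i))).const_mul (((t : ℝ) - s) / 2)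
    refine h.congr fun n => ?_
    have hstep : ∀ j, (τ n (j + 1) : ℝ) - τ n j = ((t : ℝ) - s) / 2 / n := fun j => by
      rw [hτcoe, hτcoe, hu']
      push_cast
      ring
    simp_rw [hstep]
    rw [← Finset.sum_mul, Finset.sum_range_add, Finset.sum_congr rfl fun j hj =>
      congrArg (· ^ 2) (hc₁ n i j hj)]
    simp_rw [hc₂]
    ring

end

/-! ### The midpoint decomposition -/

theorem theorem4p7 {Ω : Type*} [MeasurableSpace Ω] (P : Measure Ω) [IsProbabilityMeasure P]
    (d : ℕ) (W : ℝ≥0 → Ω → EuclideanSpace ℝ (Fin d)) (hW : IsStandardBrownianMotion W P)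
    (s t u : ℝ≥0) (hst : s ≤ t) (hu : u = (s + t) / 2) (h : ℝ) (hh : h = (t : ℝ) - s) :
    -- the four random vectors are (jointly) independent
    iIndepFun (fun k : Fin 4 =>
      (![pathIncrement W s t, spaceTimeLevyArea W s t, midpointArch W s u t,
        levyAreaDifference W s u t] k : Ω → EuclideanSpace ℝ (Fin d))) P ∧
    -- their laws
    HasLaw (pathIncrement W s t)
      (multivariateGaussian 0 (h • (1 : Matrix (Fin d) (Fin d) ℝ))) P ∧
    HasLaw (spaceTimeLevyArea W s t)
      (multivariateGaussian 0 ((h / 12) • (1 : Matrix (Fin d) (Fin d) ℝ))) P ∧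
    HasLaw (midpointArch W s u t)
      (multivariateGaussian 0 ((h / 16) • (1 : Matrix (Fin d) (Fin d) ℝ))) P ∧
    HasLaw (levyAreaDifference W s u t)
      (multivariateGaussian 0 ((h / 12) • (1 : Matrix (Fin d) (Fin d) ℝ))) P ∧
    -- the half-interval quantities, almost surely
    ∀ᵐ ω ∂P,
      pathIncrement W s u ω = (1 / 2 : ℝ) • pathIncrement W s t ω
        + (3 / 2 : ℝ) • spaceTimeLevyArea W s t ω + midpointArch W s u t ω ∧
      pathIncrement W u t ω = (1 / 2 : ℝ) • pathIncrement W s t ω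
        - (3 / 2 : ℝ) • spaceTimeLevyArea W s t ω - midpointArch W s u t ω ∧
      spaceTimeLevyArea W s u ω = (1 / 4 : ℝ) • spaceTimeLevyArea W s t ω
        - (1 / 2 : ℝ) • midpointArch W s u t ω + (1 / 2 : ℝ) • levyAreaDifference W s u t ω ∧
      spaceTimeLevyArea W u t ω = (1 / 4 : ℝ) • spaceTimeLevyArea W s t ω
        - (1 / 2 : ℝ) • midpointArch W s u t ω - (1 / 2 : ℝ) • levyAreaDifference W s u t ω := by
  have hcont := hW.ae_continuous
  have hsplit : ∀ ω, pathIncrement W s t ω = pathIncrement W s u ω + pathIncrement W u t ω :=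
    fun ω => by simp [pathIncrement]
  have hh0 : 0 ≤ h := by rw [hh, sub_nonneg]; exact_mod_cast hst
  have hmW := hW.aemeasurable_pathIncrement
  have hmH := hW.aemeasurable_spaceTimeLevyArea
  have hmZ : AEMeasurable (midpointArch W s u t) P :=
    (((hmW s u).sub (hmW u t)).const_smul (1 / 8 : ℝ)).sub
      (((hmH s u).add (hmH u t)).const_smul (3 / 4 : ℝ))
  have hmN : AEMeasurable (levyAreaDifference W s u t) P := (hmH s u).sub (hmH u t)
  obtain ⟨hind, hlaw⟩ := iIndepFun_and_hasLaw_multivariateGaussian (P := P)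
    (X := ![pathIncrement W s t, spaceTimeLevyArea W s t, midpointArch W s u t,
        levyAreaDifference W s u t]) (v := ![h, h / 12, h / 16, h / 12])
    (fun k => by fin_cases k; exacts [hmW s t, hmH s t, hmZ, hmN])
    (fun k => by fin_cases k <;> simp <;> positivity)
    (fun x => by
      -- The coefficients of `W_{s,u}`, `W_{u,t}`, `H_{s,u}`, `H_{u,t}` in the linear form
      -- `⟪W_{s,t}, x 0⟫ + ⟪H_{s,t}, x 1⟫ + ⟪Z_{s,u}, x 2⟫ + ⟪N_{s,t}, x 3⟫`.
      have key := hW.integral_cexp_halves hst hu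
        (fun i => x 0 i + x 1 i / 4 + x 2 i / 8) (fun i => x 0 i - x 1 i / 4 - x 2 i / 8)
        (fun i => x 1 i / 2 - 3 / 4 * x 2 i + x 3 i) (fun i => x 1 i / 2 - 3 / 4 * x 2 i - x 3 i)
      convert key using 1
      · refine integral_congr_ae ?_
        filter_upwards [hcont] with ω hω
        have hH := spaceTimeLevyArea_eq_of_midpoint hω hu
        congr 3
        simp only [Fin.sum_univ_four, Matrix.cons_val, hH, hsplit, midpointArch,
          levyAreaDifference, PiLp.inner_apply, ← Finset.sum_add_distrib]
        refine Finset.sum_congr rfl fun i _ => ?_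
        simp
        ring
      -- The quadratic form of the variances is diagonal in `x 0, x 1, x 2, x 3`.
      · congr 4
        simp only [Fin.sum_univ_four, Matrix.cons_val, EuclideanSpace.real_norm_sq_eq,
          Finset.mul_sum, ← Finset.sum_add_distrib, hh]
        refine Finset.sum_congr rfl fun i _ => ?_
        ring)
  refine ⟨hind, hlaw 0, hlaw 1, hlaw 2, hlaw 3, ?_⟩
  filter_upwards [hcont] with ω hω
  have hH := spaceTimeLevyArea_eq_of_midpoint hω hu
  refine ⟨?_, ?_, ?_, ?_⟩ <;> rw [hH] <;> simp only [hsplit, midpointArch, levyAreaDifference] <;>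
    module
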